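/- Let $d\ge 2$ and let $\mathbb T^d$ be the torus $[0,2\pi]^d$ with opposite faces identified. For $f\in L_2(\mathbb T^d)$ (complex-valued, Lebesgue measure $dx$) and $k\in\mathbb Z^d$ let $c_k(f)=(2\pi)^{-d/2}\int_{\mathbb T^d} f(x)\,e^{-ik\cdot x}\,dx$. For $\vec s=(s_1,\dots,s_d)$ with all $s_j>0$ and $\vec q=(q_1,\dots,q_d)$ with $q_j\in(0,\infty]$, let $H^{\vec s,\vec q}_{\rm mix}(\mathbb T^d)$ be the space of all $f\in L_2(\mathbb T^d)$ such that $$\|f\,|\,H^{\vec s,\vec q}_{\rm mix}(\mathbb T^d)\|:=\Big[\sum_{k\in\mathbb Z^d}|c_k(f)|^2\prod_{j=1}^d(1+|k_j|^{q_j})^{2s_j/q_j}\Big]^{1/2}<\infty ,$$ where, if $q_j=\infty$, the $j$-th factor is replaced by $\max(1,|k_j|)^{2s_j}$. Let $I_d:H^{\vec s,\vec q}_{\rm mix}(\mathbb T^d)\to L_2(\mathbb T^d)$, $I_df=f$, be the embedding. For a bounded linear operator $T:X\to Y$ between normed spaces and $n\in\mathbb N$, let $a_n(T:X\to Y)=\inf\{\|T-A:X\to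 Y\| : A:X\to Y \text{ bounded linear},\ \operatorname{rank}A<n\}$ be its $n$-th approximation number. **Theorem.** Let $q_1,\dots,q_d\in(0,\infty]$ and let $$0<s_1=s_2=\dots=s_\nu<s_{\nu+1}\le\dots\le s_d<\infty\qquad\text{for some integer } \nu,\ 1\le\nu<d .$$ For $j=\nu+1,\dots,d$ put $$B_j:=1+2\sum_{m=1}^\infty(1+m^{q_j})^{-\frac{s_j}{s_1q_j}},$$ where, if $q_j=\infty$, the $m$-th summand is read as $\max(1,m)^{-s_j/s_1}=m^{-s_j/s_1}$. Then all these series converge, and the following limit exists and satisfies $$\lim_{n\to\infty}\frac{n^{s_1}\,a_n\big(I_d:H^{\vec s,\vec q}_{\rm mix}(\mathbb T^d)\to L_2(\mathbb T^d)\big)}{(\ln n)^{(\nu-1)s_1}}=\Big[\frac{2^\nu}{(\nu-1)!}\prod_{j=\nu+1}^d B_j\Big]^{s_1}.$$ -/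

import Mathlib

open MeasureTheory Filter Topology
open scoped ENNReal Real ComplexConjugate InnerProductSpace

noncomputable section

/-- The `n`-th approximation number of a bounded linear operator `T : X → Y`: the infimum of
the operator norms `‖T - A‖` over all bounded linear operators `A` of rank `< n`. -/
def approxNumber {𝕜 X Y : Type*} [NontriviallyNormedField 𝕜]
    [NormedAddCommGroup X] [NormedSpace 𝕜 X] [NormedAddCommGroup Y] [NormedSpace 𝕜 Y]
    (T : X →L[𝕜] Y) (n : ℕ) : ℝ :=
  sInf {c : ℝ | ∃ A : X →L[𝕜] Y, LinearMap.rank (A : X →ₗ[𝕜] Y) < (n : Cardinal) ∧ c = ‖T - A‖}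

namespace MixedSobolev

instance fact_two_pi_pos : Fact ((0 : ℝ) < 2 * π) := ⟨Real.two_pi_pos⟩

/-- The `d`-dimensional torus: `[0, 2π]^d` with opposite faces identified. Its `volume` is the
product of the Lebesgue measures on the factors, so its total mass is `(2π)^d`. -/
abbrev Torus (d : ℕ) : Type := Fin d → AddCircle (2 * π)

/-- The complex Hilbert space `L₂(𝕋^d)`. -/
abbrev TorusL2 (d : ℕ) : Type := Lp ℂ 2 (volume : Measure (Torus d))

/-- The character `x ↦ exp(i k·x)` of the torus, see `expChar_apply_coe`. -/
def expChar {d : ℕ} (k : Fin d → ℤ) : C(Torus d, ℂ) where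
  toFun x := ∏ j, fourier (k j) (x j)
  continuous_toFun := by fun_prop

theorem expChar_apply_coe {d : ℕ} (k : Fin d → ℤ) (x : Fin d → ℝ) :
    expChar k (fun j => (x j : AddCircle (2 * π))) =
      Complex.exp (Complex.I * ∑ j, (k j : ℂ) * (x j : ℂ)) := by
  have hpi : (π : ℂ) ≠ 0 := by exact_mod_cast Real.pi_ne_zero
  simp only [expChar, ContinuousMap.coe_mk, fourier_coe_apply, Finset.mul_sum, Complex.exp_sum]
  refine Finset.prod_congr rfl fun j _ => ?_
  congr 1
  push_cast
  field_simp

/-- The Fourier coefficient `c_k(f) = (2π)^{-d/2} ∫ f(x) exp(-i k·x) dx`. -/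
def fourierCoef {d : ℕ} (k : Fin d → ℤ) (f : Torus d → ℂ) : ℂ :=
  (((2 * π) ^ (-((d : ℝ) / 2)) : ℝ) : ℂ) * ∫ x, f x * expChar (-k) x

/-- The univariate weight `(1 + |m|^q)^{t/q}`, to be read as `max(1, |m|)^t` if `q = ∞`. -/
def weight (q : ℝ≥0∞) (t : ℝ) (m : ℤ) : ℝ :=
  if q = ∞ then (max 1 |(m : ℝ)|) ^ t
  else (1 + |(m : ℝ)| ^ q.toReal) ^ (t / q.toReal)

theorem weight_pos (q : ℝ≥0∞) (t : ℝ) (m : ℤ) : 0 < weight q t m := by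
  unfold weight
  split_ifs <;> positivity

theorem one_le_weight (q : ℝ≥0∞) {t : ℝ} (ht : 0 ≤ t) (m : ℤ) : 1 ≤ weight q t m := by
  unfold weight
  split_ifs
  · exact Real.one_le_rpow (le_max_left _ _) ht
  · refine Real.one_le_rpow ?_ (div_nonneg ht ENNReal.toReal_nonneg)
    have : 0 ≤ |(m : ℝ)| ^ q.toReal := by positivity
    linarith

/-- The squared mixed weight `∏ⱼ (1 + |k_j|^{q_j})^{2 s_j / q_j}`. -/
def mixWeightSq {d : ℕ} (s : Fin d → ℝ) (q : Fin d → ℝ≥0∞) (k : Fin d → ℤ) : ℝ :=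
  ∏ j, weight (q j) (2 * s j) (k j)

theorem mixWeightSq_pos {d : ℕ} (s : Fin d → ℝ) (q : Fin d → ℝ≥0∞) (k : Fin d → ℤ) :
    0 < mixWeightSq s q k :=
  Finset.prod_pos fun _ _ => weight_pos _ _ _

theorem one_le_mixWeightSq {d : ℕ} {s : Fin d → ℝ} (hs : ∀ j, 0 < s j) (q : Fin d → ℝ≥0∞)
    (k : Fin d → ℤ) : 1 ≤ mixWeightSq s q k := by
  unfold mixWeightSq
  have h : ∏ _j : Fin d, (1 : ℝ) ≤ ∏ j, weight (q j) (2 * s j) (k j) :=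
    Finset.prod_le_prod (fun _ _ => zero_le_one)
      fun j _ => one_le_weight _ (by have := hs j; linarith) _
  simpa using h

/-! ### Fourier coefficients as coordinates in an orthonormal basis of `L₂` -/

theorem expChar_neg {d : ℕ} (k : Fin d → ℤ) (x : Torus d) :
    expChar (-k) x = conj (expChar k x) := by
  simp only [expChar, Pi.neg_apply, fourier_neg, ContinuousMap.coe_mk, map_prod]

theorem expChar_add {d : ℕ} (k l : Fin d → ℤ) (x : Torus d) :
    expChar (k + l) x = expChar k x * expChar l x := by
  simp only [expChar, Pi.add_apply, fourier_add, ContinuousMap.coe_mk, ← Finset.prod_mul_distrib]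

theorem expChar_zero {d : ℕ} (x : Torus d) : expChar (0 : Fin d → ℤ) x = 1 := by
  simp only [expChar, Pi.zero_apply, fourier_zero, Finset.prod_const_one, ContinuousMap.coe_mk]

theorem expChar_single {d : ℕ} (x : Torus d) (i : Fin d) :
    expChar (Pi.single i 1) x = fourier 1 (x i) := by
  simp only [expChar, ContinuousMap.coe_mk]
  rw [Finset.prod_eq_single i]
  · simp
  · intro j _ hj
    rw [Pi.single_eq_of_ne hj, fourier_zero]
  · simp

/-- The star subalgebra of trigonometric polynomials. -/
def trigPoly (d : ℕ) : StarSubalgebra ℂ C(Torus d, ℂ) where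
  toSubalgebra := Algebra.adjoin ℂ (Set.range expChar)
  star_mem' := by
    change Algebra.adjoin ℂ (Set.range expChar) ≤ star (Algebra.adjoin ℂ (Set.range expChar))
    refine Algebra.adjoin_le ?_
    rintro _ ⟨n, rfl⟩
    refine Algebra.subset_adjoin ⟨-n, ?_⟩
    ext1 x
    simp only [expChar_neg, starRingEnd_apply, ContinuousMap.star_apply]

theorem trigPoly_coe (d : ℕ) :
    (trigPoly d).toSubalgebra.toSubmodule = Submodule.span ℂ (Set.range expChar) := by
  apply Algebra.adjoin_eq_span_of_subset
  refine .trans (fun x ↦ Submonoid.closure_induction (fun _ ↦ id) ⟨0, ?_⟩ ?_)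
    Submodule.subset_span
  · ext z
    simp [expChar_zero]
  · rintro _ _ _ _ ⟨m, rfl⟩ ⟨n, rfl⟩
    refine ⟨m + n, ?_⟩
    ext z
    simp [expChar_add]

theorem trigPoly_separatesPoints (d : ℕ) : (trigPoly d).SeparatesPoints := by
  intro x y hxy
  rw [Ne, funext_iff, not_forall] at hxy
  obtain ⟨i, hi⟩ := hxy
  refine ⟨_, ⟨expChar (Pi.single i 1), Algebra.subset_adjoin ⟨Pi.single i 1, rfl⟩, rfl⟩, ?_⟩
  change expChar (Pi.single i 1) x ≠ expChar (Pi.single i 1) y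
  rw [expChar_single, expChar_single, fourier_one, fourier_one]
  intro h
  exact hi (AddCircle.injective_toCircle Real.two_pi_pos.ne' (Circle.ext h))

theorem span_expChar_closure_eq_top (d : ℕ) :
    (Submodule.span ℂ (Set.range (expChar (d := d)))).topologicalClosure = ⊤ := by
  rw [← trigPoly_coe]
  exact congr_arg (Subalgebra.toSubmodule <| StarSubalgebra.toSubalgebra ·)
    (ContinuousMap.starSubalgebra_topologicalClosure_eq_top_of_separatesPoints _
      (trigPoly_separatesPoints d))

/-- The normalized character `(2π)^{-d/2} exp(i k·x)` as an element of `L₂`. -/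
def basisFun {d : ℕ} (k : Fin d → ℤ) : TorusL2 d :=
  (((2 * π) ^ (-((d : ℝ) / 2)) : ℝ) : ℂ) • ContinuousMap.toLp (E := ℂ) 2 volume ℂ (expChar k)

theorem integral_fourier (n : ℤ) :
    ∫ x : AddCircle (2 * π), fourier n x = if n = 0 then ((2 * π : ℝ) : ℂ) else 0 := by
  split_ifs with h
  · subst h
    simp [Measure.real, Real.pi_pos.le]
  · have hh : ∫ x : AddCircle (2 * π), fourier n x ∂AddCircle.haarAddCircle = 0 := by
      have := (orthonormal_iff_ite.mp (orthonormal_fourier (T := 2 * π))) 0 n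
      rw [if_neg (Ne.symm h)] at this
      simpa [ContinuousMap.inner_toLp] using this
    rw [AddCircle.volume_eq_smul_haarAddCircle, integral_smul_measure, hh, smul_zero]

theorem integral_expChar {d : ℕ} (k : Fin d → ℤ) :
    ∫ x : Torus d, expChar k x = if k = 0 then (((2 * π) ^ d : ℝ) : ℂ) else 0 := by
  simp only [expChar, ContinuousMap.coe_mk]
  rw [MeasureTheory.integral_fintype_prod_volume_eq_prod (fun j (y : AddCircle (2 * π)) =>
    fourier (k j) y)]
  simp only [integral_fourier]
  split_ifs with h
  · subst h
    simp
  · obtain ⟨i, hi⟩ := Function.ne_iff.mp h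
    exact Finset.prod_eq_zero (Finset.mem_univ i) (if_neg hi)

theorem normalization_sq (d : ℕ) :
    ((2 * π) ^ (-((d : ℝ) / 2)) : ℝ) * ((2 * π) ^ (-((d : ℝ) / 2)) : ℝ) * (2 * π) ^ d = 1 := by
  have h := Real.two_pi_pos
  rw [← Real.rpow_natCast (2 * π) d, ← Real.rpow_add h, ← Real.rpow_add h]
  rw [show -((d : ℝ) / 2) + -((d : ℝ) / 2) + (d : ℝ) = 0 by ring, Real.rpow_zero]

theorem orthonormal_basisFun (d : ℕ) : Orthonormal ℂ (basisFun (d := d)) := by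
  rw [orthonormal_iff_ite]
  intro k l
  simp only [basisFun, inner_smul_left, inner_smul_right, ContinuousMap.inner_toLp,
    ← expChar_neg, ← expChar_add, integral_expChar, Complex.conj_ofReal]
  by_cases h : k = l
  · subst h
    simp only [add_neg_cancel, if_true]
    rw [← mul_assoc]
    exact_mod_cast normalization_sq d
  · rw [if_neg h, if_neg, mul_zero, mul_zero]
    intro h'
    exact h (add_neg_eq_zero.mp h').symm

theorem span_basisFun_closure_eq_top (d : ℕ) :
    (Submodule.span ℂ (Set.range (basisFun (d := d)))).topologicalClosure = ⊤ := by
  have h1 : (Submodule.span ℂ (Set.range fun k : Fin d → ℤ =>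
      ContinuousMap.toLp (E := ℂ) 2 (volume : Measure (Torus d)) ℂ
        (expChar k))).topologicalClosure = ⊤ := by
    simpa only [Submodule.map_span, ContinuousLinearMap.coe_coe, ← Set.range_comp,
      Function.comp_def] using
      (ContinuousMap.toLp_denseRange ℂ (volume : Measure (Torus d)) ℂ
        (by simp : (2 : ℝ≥0∞) ≠ ∞)).topologicalClosure_map_submodule
        (span_expChar_closure_eq_top d)
  have h2 : Submodule.span ℂ (Set.range fun k : Fin d → ℤ =>
      ContinuousMap.toLp (E := ℂ) 2 (volume : Measure (Torus d)) ℂ (expChar k)) ≤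
      Submodule.span ℂ (Set.range (basisFun (d := d))) := by
    rw [Submodule.span_le]
    rintro _ ⟨k, rfl⟩
    have hc : (((2 * π) ^ (-((d : ℝ) / 2)) : ℝ) : ℂ) ≠ 0 := by
      exact_mod_cast (Real.rpow_pos_of_pos Real.two_pi_pos _).ne'
    have := Submodule.smul_mem _ (((2 * π) ^ (-((d : ℝ) / 2)) : ℝ) : ℂ)⁻¹
      (Submodule.subset_span (R := ℂ) (Set.mem_range_self (f := basisFun (d := d)) k))
    rwa [basisFun, smul_smul, inv_mul_cancel₀ hc, one_smul] at this
  exact top_le_iff.mp (h1 ▸ Submodule.topologicalClosure_mono h2)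

/-- The orthonormal basis `(2π)^{-d/2} exp(i k·x)`, `k ∈ ℤ^d`, of `L₂(𝕋^d)`. -/
def torusBasis (d : ℕ) : HilbertBasis (Fin d → ℤ) ℂ (TorusL2 d) :=
  HilbertBasis.mk (orthonormal_basisFun d) (span_basisFun_closure_eq_top d).ge

theorem fourierCoef_eq_repr {d : ℕ} (f : TorusL2 d) (k : Fin d → ℤ) :
    fourierCoef k f = (torusBasis d).repr f k := by
  rw [HilbertBasis.repr_apply_apply, torusBasis, HilbertBasis.coe_mk, basisFun, inner_smul_left,
    Complex.conj_ofReal, fourierCoef, L2.inner_def]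
  congr 1
  refine integral_congr_ae ?_
  filter_upwards [ContinuousMap.coeFn_toLp (p := 2) (𝕜 := ℂ) (volume : Measure (Torus d))
    (expChar k)] with x hx
  rw [hx, expChar_neg]
  simp

theorem fourierCoef_add {d : ℕ} (f g : TorusL2 d) (k : Fin d → ℤ) :
    fourierCoef k ⇑(f + g) = fourierCoef k f + fourierCoef k g := by
  rw [fourierCoef_eq_repr, fourierCoef_eq_repr, fourierCoef_eq_repr, map_add]
  rfl

theorem fourierCoef_smul {d : ℕ} (c : ℂ) (f : TorusL2 d) (k : Fin d → ℤ) :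
    fourierCoef k ⇑(c • f) = c * fourierCoef k f := by
  rw [fourierCoef_eq_repr, fourierCoef_eq_repr, map_smul]
  rfl

theorem fourierCoef_zero {d : ℕ} (k : Fin d → ℤ) :
    fourierCoef k ⇑(0 : TorusL2 d) = 0 := by
  simp only [fourierCoef_eq_repr, map_zero, lp.coeFn_zero, Pi.zero_apply]

/-- Parseval's identity. -/
theorem hasSum_sq_fourierCoef {d : ℕ} (f : TorusL2 d) :
    HasSum (fun k => ‖fourierCoef k f‖ ^ 2) (‖f‖ ^ 2) := by
  have h := lp.hasSum_norm (p := 2) (by simp) ((torusBasis d).repr f)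
  simpa [fourierCoef_eq_repr] using h

/-! ### The Sobolev space of anisotropic mixed smoothness -/

/-- `√(mixWeightSq s q k) * c_k(f)`, whose `ℓ₂(ℤ^d)` norm is the Sobolev norm of `f`. -/
def weightedCoef {d : ℕ} (s : Fin d → ℝ) (q : Fin d → ℝ≥0∞) (f : TorusL2 d)
    (k : Fin d → ℤ) : ℂ :=
  ((√(mixWeightSq s q k) : ℝ) : ℂ) * fourierCoef k f

theorem norm_weightedCoef_sq {d : ℕ} (s : Fin d → ℝ) (q : Fin d → ℝ≥0∞) (f : TorusL2 d)
    (k : Fin d → ℤ) :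
    ‖weightedCoef s q f k‖ ^ 2 = ‖fourierCoef k f‖ ^ 2 * mixWeightSq s q k := by
  rw [weightedCoef, norm_mul, mul_pow, Complex.norm_real, Real.norm_eq_abs, sq_abs,
    Real.sq_sqrt (mixWeightSq_pos s q k).le, mul_comm]

theorem summable_iff_memlp {d : ℕ} (s : Fin d → ℝ) (q : Fin d → ℝ≥0∞) (f : TorusL2 d) :
    (Summable fun k => ‖fourierCoef k f‖ ^ 2 * mixWeightSq s q k) ↔
      Memℓp (weightedCoef s q f) 2 := by
  rw [memℓp_gen_iff (by simp)]
  simp [norm_weightedCoef_sq]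

theorem weightedCoef_add {d : ℕ} (s : Fin d → ℝ) (q : Fin d → ℝ≥0∞) (f g : TorusL2 d) :
    weightedCoef s q (f + g) = weightedCoef s q f + weightedCoef s q g := by
  funext k
  rw [Pi.add_apply, weightedCoef, weightedCoef, weightedCoef, fourierCoef_add, mul_add]

theorem weightedCoef_smul {d : ℕ} (s : Fin d → ℝ) (q : Fin d → ℝ≥0∞) (c : ℂ) (f : TorusL2 d) :
    weightedCoef s q (c • f) = c • weightedCoef s q f := by
  funext k
  rw [Pi.smul_apply, weightedCoef, weightedCoef, fourierCoef_smul, smul_eq_mul, mul_left_comm]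

/-- The set of all `f ∈ L₂(𝕋^d)` with `∑_k |c_k(f)|² ∏ⱼ (1 + |k_j|^{q_j})^{2 s_j / q_j} < ∞`, as a
linear subspace of `L₂(𝕋^d)`. -/
def sobolevSubmodule {d : ℕ} (s : Fin d → ℝ) (q : Fin d → ℝ≥0∞) : Submodule ℂ (TorusL2 d) where
  carrier := {f | Summable fun k => ‖fourierCoef k f‖ ^ 2 * mixWeightSq s q k}
  zero_mem' := by
    simp only [Set.mem_ofPred_eq, fourierCoef_zero]
    simp
  add_mem' := by
    intro f g hf hg
    rw [Set.mem_ofPred_eq, summable_iff_memlp] at hf hg ⊢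
    rw [weightedCoef_add]
    exact hf.add hg
  smul_mem' := by
    intro c f hf
    rw [Set.mem_ofPred_eq, summable_iff_memlp] at hf ⊢
    rw [weightedCoef_smul]
    exact hf.const_smul c

/-- The Sobolev space `H^{s,q}_mix(𝕋^d)`. It has its own norm, and not the one of `L₂`. -/
def SobolevSpace {d : ℕ} (s : Fin d → ℝ) (q : Fin d → ℝ≥0∞) : Type :=
  ↥(sobolevSubmodule s q)

namespace SobolevSpace

variable {d : ℕ} (s : Fin d → ℝ) (q : Fin d → ℝ≥0∞)

instance : AddCommGroup (SobolevSpace s q) :=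
  inferInstanceAs (AddCommGroup ↥(sobolevSubmodule s q))

instance : Module ℂ (SobolevSpace s q) :=
  inferInstanceAs (Module ℂ ↥(sobolevSubmodule s q))

/-- The identity `H^{s,q}_mix(𝕋^d) → L₂(𝕋^d)` as a linear map. -/
def toL2 : SobolevSpace s q →ₗ[ℂ] TorusL2 d := (sobolevSubmodule s q).subtype

theorem summable (f : SobolevSpace s q) :
    Summable fun k => ‖fourierCoef k (toL2 s q f)‖ ^ 2 * mixWeightSq s q k :=
  f.2

/-- `‖f | H^{s,q}_mix‖ = (∑_k |c_k(f)|² ∏ⱼ (1 + |k_j|^{q_j})^{2 s_j / q_j})^{1/2}`. -/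
instance : Norm (SobolevSpace s q) where
  norm f := √(∑' k, ‖fourierCoef k (toL2 s q f)‖ ^ 2 * mixWeightSq s q k)

theorem norm_def (f : SobolevSpace s q) :
    ‖f‖ = √(∑' k, ‖fourierCoef k (toL2 s q f)‖ ^ 2 * mixWeightSq s q k) := rfl

/-- The map `f ↦ (√(mixWeightSq s q k) * c_k(f))_k` into `ℓ₂(ℤ^d)`. -/
def toSeq : SobolevSpace s q →ₗ[ℂ] lp (fun _ : Fin d → ℤ => ℂ) 2 where
  toFun f := ⟨weightedCoef s q (toL2 s q f), (summable_iff_memlp s q _).1 (summable s q f)⟩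
  map_add' f g := by
    ext1
    simp only [map_add, weightedCoef_add]
    rfl
  map_smul' c f := by
    ext1
    simp only [map_smul, weightedCoef_smul]
    rfl

theorem norm_toSeq (f : SobolevSpace s q) : ‖toSeq s q f‖ = ‖f‖ := by
  have h := lp.norm_eq_tsum_rpow (p := 2) (by simp) (toSeq s q f)
  rw [h, norm_def, Real.sqrt_eq_rpow]
  simp [toSeq, norm_weightedCoef_sq]

theorem norm_toL2_le {s : Fin d → ℝ} (hs : ∀ j, 0 < s j) (q : Fin d → ℝ≥0∞)
    (f : SobolevSpace s q) : ‖toL2 s q f‖ ≤ ‖f‖ := by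
  rw [norm_def]
  refine Real.le_sqrt_of_sq_le ?_
  refine hasSum_le (fun k => ?_) (hasSum_sq_fourierCoef _) (summable s q f).hasSum
  exact le_mul_of_one_le_right (sq_nonneg _) (one_le_mixWeightSq hs q k)

theorem eq_zero_of_norm_eq_zero (f : SobolevSpace s q) (hf : ‖f‖ = 0) : f = 0 := by
  rw [← norm_toSeq, norm_eq_zero] at hf
  have h0 : ∀ k, fourierCoef k (toL2 s q f) = 0 := by
    intro k
    have hk : weightedCoef s q (toL2 s q f) k = 0 := congrFun (congrArg Subtype.val hf) k
    rw [weightedCoef, mul_eq_zero] at hk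
    refine hk.resolve_left ?_
    exact_mod_cast (Real.sqrt_pos.2 (mixWeightSq_pos s q k)).ne'
  have h1 : ‖toL2 s q f‖ ^ 2 = 0 := by
    refine (hasSum_sq_fourierCoef (toL2 s q f)).unique ?_
    simp [h0]
  have h2 : toL2 s q f = 0 := by simpa using h1
  exact Subtype.ext h2

theorem normedSpaceCore : NormedSpace.Core ℂ (SobolevSpace s q) where
  norm_nonneg f := Real.sqrt_nonneg _
  norm_smul c f := by rw [← norm_toSeq, map_smul, norm_smul, norm_toSeq]
  norm_triangle f g := by
    rw [← norm_toSeq, map_add, ← norm_toSeq, ← norm_toSeq s q g]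
    exact norm_add_le _ _
  norm_eq_zero_iff f := by
    refine ⟨eq_zero_of_norm_eq_zero s q f, ?_⟩
    rintro rfl
    rw [← norm_toSeq, map_zero, norm_zero]

instance : NormedAddCommGroup (SobolevSpace s q) :=
  NormedAddCommGroup.ofCore (normedSpaceCore s q)

instance : NormedSpace ℂ (SobolevSpace s q) :=
  NormedSpace.ofCore (normedSpaceCore s q)

end SobolevSpace

/-- The embedding `I_d : H^{s,q}_mix(𝕋^d) → L₂(𝕋^d)`, `f ↦ f`, as a bounded linear operator. -/
def embedding {d : ℕ} {s : Fin d → ℝ} (hs : ∀ j, 0 < s j) (q : Fin d → ℝ≥0∞) :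
    SobolevSpace s q →L[ℂ] TorusL2 d :=
  LinearMap.mkContinuous (SobolevSpace.toL2 s q) 1
    fun f => by simpa using SobolevSpace.norm_toL2_le hs q f

/-- The summands `(1 + m^q)^{-s/(s₁ q)}` (read as `max(1, m)^{-s/s₁}` if `q = ∞`), `m = 1, 2, …`,
of the series in `constB`; here `r = s/s₁`, and the index of the sequence is `m - 1`. -/
def termB (q : ℝ≥0∞) (r : ℝ) (m : ℕ) : ℝ := weight q (-r) ((m : ℤ) + 1)

/-- `B = 1 + 2 ∑_{m ≥ 1} (1 + m^q)^{-r/q}`. -/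
def constB (q : ℝ≥0∞) (r : ℝ) : ℝ := 1 + 2 * ∑' m : ℕ, termB q r m

end MixedSobolev

end

/-!
The embedding is diagonal with respect to the orthonormal basis of normalized characters, with
singular numbers `(∏ⱼ weight (q j) (s j) (k j))⁻¹`, `k ∈ ℤ^d`. Its `n`-th approximation number is
therefore the `n`-th largest of these (`approxNumber_embedding_le`, by truncation of the Fourier
series, and `le_approxNumber_embedding`, since an operator of rank `< n` vanishes somewhere on the
span of any `n` basis functions). After taking `s₁`-th roots this reduces the claim to the
asymptotics of the number of lattice points `N(T) = #{k | ∏ⱼ weight (q j) (s j / s₁) (k j) ≤ T}`,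
namely `N(T) ~ C T (ln T)^(ν-1)` with `C = 2^ν / (ν-1)! * ∏_{j ≥ ν} Bⱼ`, where coordinates are
numbered from `0` and `Bⱼ = constB (q j) (s j / s₁)`; this relation is inverted in
`GrowsLike.tendsto_rpow_mul`.

The lattice points are counted by induction on the dimension (`growsLike_prod_weight`). In one
dimension `weight q 1 m` behaves like `|m|`, so there are `~ 2 T` points (`growsLike_weight_one`).
A further coordinate of the minimal smoothness `s₁` turns `C T (ln T)^a` into
`2 C T (ln T)^(a+1) / (a+1)` (`GrowsLike.mul_linear`), by partial summation. A coordinate of larger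
smoothness has summable reciprocal weights, with sum `Bⱼ` over `ℤ`, and multiplies the constant by
`Bⱼ` (`GrowsLike.mul_summable`), by dominated convergence.
-/

noncomputable section

namespace MixedSobolev

/-! ### Counting functions and their growth -/

/-- The number of indices `i` with `x i ≤ T`, as a real number. Since `Set.ncard` of an infinite
set is `0`, it is meaningful only if these sets are finite, as for an `IsLocallyFiniteFamily`. -/
def countLE {ι : Type*} (x : ι → ℝ) (T : ℝ) : ℝ := ({i | x i ≤ T}.ncard : ℝ)

/-- A family of reals `≥ 1` of which only finitely many lie below any given bound. -/
structure IsLocallyFiniteFamily {ι : Type*} (x : ι → ℝ) : Prop where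
  one_le : ∀ i, 1 ≤ x i
  finite : ∀ T, {i | x i ≤ T}.Finite

/-- `N(T) ~ C T (ln T)^a` as `T → ∞` (for `C ≠ 0`; for `C = 0` it means little-o). -/
def GrowsLike (N : ℝ → ℝ) (C : ℝ) (a : ℕ) : Prop :=
  Tendsto (fun T => N T / (T * Real.log T ^ a)) atTop (𝓝 C)

section Count

variable {ι κ : Type*} {x : ι → ℝ} {y : κ → ℝ}

theorem countLE_nonneg (x : ι → ℝ) (T : ℝ) : 0 ≤ countLE x T := Nat.cast_nonneg _

theorem IsLocallyFiniteFamily.pos (hx : IsLocallyFiniteFamily x) (i : ι) : 0 < x i :=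
  zero_lt_one.trans_le (hx.one_le i)

theorem IsLocallyFiniteFamily.countLE_mono (hx : IsLocallyFiniteFamily x) :
    Monotone (countLE x) := fun _ T h =>
  Nat.cast_le.2 (Set.ncard_le_ncard (fun _ hi => le_trans hi h) (hx.finite T))

theorem IsLocallyFiniteFamily.countLE_eq_zero (hx : IsLocallyFiniteFamily x) {T : ℝ}
    (hT : T < 1) : countLE x T = 0 := by
  have : {i | x i ≤ T} = ∅ :=
    Set.eq_empty_of_forall_notMem fun i hi => (hx.one_le i).not_gt (lt_of_le_of_lt hi hT)
  simp [countLE, this]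

theorem IsLocallyFiniteFamily.comp_equiv (hx : IsLocallyFiniteFamily x) (e : κ ≃ ι) :
    IsLocallyFiniteFamily (x ∘ e) where
  one_le j := hx.one_le (e j)
  finite T := (hx.finite T).preimage e.injective.injOn

theorem countLE_comp_equiv (x : ι → ℝ) (e : κ ≃ ι) (T : ℝ) :
    countLE (x ∘ e) T = countLE x T := by
  have : {j | (x ∘ e) j ≤ T} = e ⁻¹' {i | x i ≤ T} := rfl
  rw [countLE, countLE, this, Set.ncard_preimage_of_injective_subset_range e.injective]
  simp [e.surjective.range_eq]

theorem IsLocallyFiniteFamily.mul (hx : IsLocallyFiniteFamily x) (hy : IsLocallyFiniteFamily y) :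
    IsLocallyFiniteFamily (fun p : ι × κ => x p.1 * y p.2) where
  one_le p := one_le_mul_of_one_le_of_one_le (hx.one_le _) (hy.one_le _)
  finite T := by
    refine ((hx.finite T).prod (hy.finite T)).subset fun p hp => ⟨?_, ?_⟩
    · exact (le_mul_of_one_le_right (hx.pos _).le (hy.one_le _)).trans hp
    · exact (le_mul_of_one_le_left (hy.pos _).le (hx.one_le _)).trans hp

theorem countLE_mul (hx : IsLocallyFiniteFamily x) (hy : IsLocallyFiniteFamily y) (T : ℝ) :
    countLE (fun p : ι × κ => x p.1 * y p.2) T =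
      ∑ j ∈ (hy.finite T).toFinset, countLE x (T / y j) := by
  classical
  rw [countLE, Set.ncard_eq_toFinset_card _ ((hx.mul hy).finite T),
    Finset.card_eq_sum_card_fiberwise (f := Prod.snd) (t := (hy.finite T).toFinset)]
  · push_cast
    refine Finset.sum_congr rfl fun j _ => ?_
    rw [countLE, ← Set.ncard_image_of_injective _ (Prod.mk_left_injective j),
      ← Set.ncard_coe_finset]
    congr 2
    ext ⟨i, j'⟩
    simp only [Finset.coe_filter, Set.Finite.mem_toFinset, Set.mem_ofPred_eq, Set.mem_image,
      Prod.mk.injEq, le_div_iff₀ (hy.pos j)]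
    constructor
    · rintro ⟨h, rfl⟩
      exact ⟨i, h, rfl, rfl⟩
    · rintro ⟨i', h, rfl, rfl⟩
      exact ⟨h, rfl⟩
  · intro p hp
    simp only [Set.Finite.coe_toFinset, Set.mem_ofPred_eq] at hp ⊢
    exact (le_mul_of_one_le_left (hy.pos _).le (hx.one_le _)).trans hp

end Count

section Growth

variable {N : ℝ → ℝ} {C : ℝ} {a : ℕ}

theorem one_le_log_pow {T : ℝ} (hT : Real.exp 1 ≤ T) (a : ℕ) : 1 ≤ Real.log T ^ a :=
  one_le_pow₀ ((Real.le_log_iff_exp_le ((Real.exp_pos 1).trans_le hT)).2 hT)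

/-- On `[1, ∞)`, where `T (ln T)^a` may vanish, the growth of a monotone function gives a bound
with an arbitrarily small relative error plus a constant. -/
theorem GrowsLike.exists_abs_sub_le (h : GrowsLike N C a) (hN : Monotone N) (h0 : ∀ T, 0 ≤ N T)
    {ε : ℝ} (hε : 0 < ε) :
    ∃ K, 0 ≤ K ∧ ∀ T, 1 ≤ T →
      |N T - C * (T * Real.log T ^ a)| ≤ ε * (T * Real.log T ^ a) + K := by
  obtain ⟨R, hR⟩ := eventually_atTop.1 ((Metric.tendsto_nhds.1 h ε hε).and
    (eventually_ge_atTop (Real.exp 1)))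
  have hRe : Real.exp 1 ≤ R := (hR R le_rfl).2
  have hR1 : 1 ≤ R := (Real.one_le_exp zero_le_one).trans hRe
  have hRl : 0 ≤ Real.log R := Real.log_nonneg hR1
  have hK : 0 ≤ |C| * (R * Real.log R ^ a) := by positivity
  refine ⟨N R + |C| * (R * Real.log R ^ a), add_nonneg (h0 R) hK, fun T hT => ?_⟩
  have hTl : 0 ≤ Real.log T := Real.log_nonneg hT
  rcases le_total R T with hRT | hRT
  · have h1 := (hR T hRT).1
    have hp : 0 < T * Real.log T ^ a :=
      mul_pos (by linarith) (zero_lt_one.trans_le (one_le_log_pow (hRe.trans hRT) a))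
    have h2 : N T - C * (T * Real.log T ^ a) =
        (N T / (T * Real.log T ^ a) - C) * (T * Real.log T ^ a) := by
      rw [sub_mul, div_mul_cancel₀ _ hp.ne']
    rw [h2, abs_mul, abs_of_pos hp]
    rw [Real.dist_eq] at h1
    have := mul_le_mul_of_nonneg_right h1.le hp.le
    linarith [h0 R]
  · have h1 : |N T| ≤ N R := by
      rw [abs_of_nonneg (h0 T)]
      exact hN hRT
    have h2 : |C * (T * Real.log T ^ a)| ≤ |C| * (R * Real.log R ^ a) := by
      rw [abs_mul, abs_of_nonneg (by positivity : 0 ≤ T * Real.log T ^ a)]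
      gcongr
    have h3 : 0 ≤ ε * (T * Real.log T ^ a) := by positivity
    have := abs_sub (N T) (C * (T * Real.log T ^ a))
    linarith

theorem GrowsLike.exists_le (h : GrowsLike N C a) (hN : Monotone N) (h0 : ∀ T, 0 ≤ N T) :
    ∃ K, 0 ≤ K ∧ ∀ T, 1 ≤ T → N T ≤ K * (T * (1 + Real.log T) ^ a) := by
  obtain ⟨K, hK, h⟩ := h.exists_abs_sub_le hN h0 one_pos
  refine ⟨|C| + 1 + K, by positivity, fun T hT => ?_⟩
  have hTl : 0 ≤ Real.log T := Real.log_nonneg hT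
  have h1 := (abs_sub_le_iff.1 (h T hT)).1
  have h2 : T * Real.log T ^ a ≤ T * (1 + Real.log T) ^ a := by gcongr; linarith
  have h3 : 1 ≤ T * (1 + Real.log T) ^ a :=
    one_le_mul_of_one_le_of_one_le hT (one_le_pow₀ (by linarith))
  have h4 : C * (T * Real.log T ^ a) ≤ |C| * (T * (1 + Real.log T) ^ a) :=
    (mul_le_mul_of_nonneg_right (le_abs_self C) (by positivity)).trans (by gcongr)
  nlinarith

/-- A relative error that is arbitrarily small up to an additive term of lower order yields a
limit. -/
theorem tendsto_of_forall_abs_sub_le {α : Type*} {l : Filter α} {f g : α → ℝ} {c M : ℝ}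
    (hg : Tendsto g l (𝓝 c))
    (h : ∀ ε > 0, ∃ r : α → ℝ, Tendsto r l (𝓝 0) ∧ ∀ᶠ t in l, |f t - g t| ≤ ε * M + r t) :
    Tendsto f l (𝓝 c) := by
  have h0 : Tendsto (fun t => f t - g t) l (𝓝 0) := by
    rw [Metric.tendsto_nhds]
    intro δ hδ
    have hM : 0 < |M| + 1 := by positivity
    obtain ⟨r, hr, hb⟩ := h (δ / 2 / (|M| + 1)) (by positivity)
    filter_upwards [hb, (Metric.tendsto_nhds.1 hr) (δ / 2) (by positivity)] with t ht hrt
    have h1 : δ / 2 / (|M| + 1) * M ≤ δ / 2 := by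
      rw [div_mul_eq_mul_div, div_le_iff₀ hM]
      nlinarith [le_abs_self M]
    rw [Real.dist_eq, sub_zero] at *
    linarith [le_abs_self (r t)]
  simpa using h0.add hg

end Growth

/-! ### Partial summation -/

section Abel

variable {κ : Type*} {y : κ → ℝ}

theorem integral_inv_sq {u v : ℝ} (hu : 0 < u) (huv : u ≤ v) :
    ∫ t in u..v, (t ^ 2)⁻¹ = u⁻¹ - v⁻¹ := by
  have hpos : ∀ t ∈ Set.uIcc u v, t ≠ 0 := fun t ht => by
    rw [Set.uIcc_of_le huv] at ht
    exact (hu.trans_le ht.1).ne'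
  rw [intervalIntegral.integral_eq_sub_of_hasDerivAt (f := fun t => -t⁻¹)]
  · ring
  · intro t ht
    simpa using (hasDerivAt_inv (hpos t ht)).fun_neg
  · refine ContinuousOn.intervalIntegrable fun t ht => ?_
    exact ((continuousAt_id.pow 2).inv₀ (pow_ne_zero 2 (hpos t ht))).continuousWithinAt

theorem integral_log_pow_div {T : ℝ} (hT : 1 ≤ T) (a : ℕ) :
    ∫ t in (1 : ℝ)..T, Real.log t ^ a / t = Real.log T ^ (a + 1) / (a + 1) := by
  have hpos : ∀ t ∈ Set.uIcc 1 T, t ≠ 0 := fun t ht => by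
    rw [Set.uIcc_of_le hT] at ht
    exact (zero_lt_one.trans_le ht.1).ne'
  rw [intervalIntegral.integral_eq_sub_of_hasDerivAt
    (f := fun t => Real.log t ^ (a + 1) / (a + 1))]
  · simp
  · intro t ht
    refine (((Real.hasDerivAt_log (hpos t ht)).fun_pow (a + 1)).div_const
      ((a : ℝ) + 1)).congr_deriv ?_
    have : (a : ℝ) + 1 ≠ 0 := by positivity
    rw [Nat.add_sub_cancel]
    push_cast
    field_simp
  · refine ContinuousOn.intervalIntegrable fun t ht => ?_
    exact (((Real.continuousAt_log (hpos t ht)).pow a).div continuousAt_id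
      (hpos t ht)).continuousWithinAt

theorem intervalIntegrable_log_pow_div {T : ℝ} (hT : 1 ≤ T) (a : ℕ) :
    IntervalIntegrable (fun t => Real.log t ^ a / t) volume 1 T := by
  refine ContinuousOn.intervalIntegrable fun t ht => ?_
  rw [Set.uIcc_of_le hT] at ht
  have h0 : t ≠ 0 := (zero_lt_one.trans_le ht.1).ne'
  exact (((Real.continuousAt_log h0).pow a).div continuousAt_id h0).continuousWithinAt

theorem intervalIntegrable_inv_sq {T : ℝ} (hT : 1 ≤ T) :
    IntervalIntegrable (fun t : ℝ => (t ^ 2)⁻¹) volume 1 T := by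
  refine ContinuousOn.intervalIntegrable fun t ht => ?_
  rw [Set.uIcc_of_le hT] at ht
  have h0 : t ≠ 0 := (zero_lt_one.trans_le ht.1).ne'
  exact ((continuousAt_id.pow 2).inv₀ (pow_ne_zero 2 h0)).continuousWithinAt

theorem intervalIntegrable_mul_inv_sq {N : ℝ → ℝ} (hN : Monotone N) {T : ℝ} (hT : 1 ≤ T) :
    IntervalIntegrable (fun t => N t * (t ^ 2)⁻¹) volume 1 T := by
  refine (hN.intervalIntegrable).mul_continuousOn fun t ht => ?_
  rw [Set.uIcc_of_le hT] at ht
  have h0 : t ≠ 0 := (zero_lt_one.trans_le ht.1).ne'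
  exact ((continuousAt_id.pow 2).inv₀ (pow_ne_zero 2 h0)).continuousWithinAt

/-- Partial summation: `∑_{y_j ≤ T} 1 / y_j = N(T) / T + ∫₁ᵀ N(t) / t² dt`. -/
theorem sum_inv_eq (hy : IsLocallyFiniteFamily y) {T : ℝ} (hT : 1 ≤ T) :
    ∑ j ∈ (hy.finite T).toFinset, (y j)⁻¹ =
      countLE y T / T + ∫ t in (1 : ℝ)..T, countLE y t * (t ^ 2)⁻¹ := by
  classical
  -- `1 / y = 1 / T + ∫_y^T dt / t²`, with the integral extended to `[1, T]` by an indicator.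
  have hterm : ∀ j ∈ (hy.finite T).toFinset,
      (y j)⁻¹ = T⁻¹ + ∫ t in (1 : ℝ)..T, (Set.Ici (y j)).indicator (fun t => (t ^ 2)⁻¹) t := by
    intro j hj
    have hjT : y j ≤ T := by simpa using hj
    have h1 := hy.one_le j
    rw [intervalIntegral.integral_of_le hT, integral_indicator measurableSet_Ici,
      Measure.restrict_restrict measurableSet_Ici]
    have hset : (Set.Ici (y j) ∩ Set.Ioc 1 T : Set ℝ) =ᵐ[volume] Set.Ioc (y j) T := by
      refine (Ioi_ae_eq_Ici.symm.inter (ae_eq_refl _)).trans (Eventually.of_forall fun t => ?_)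
      refine propext ⟨fun ht => ⟨ht.1, ht.2.2⟩, fun ht => ⟨ht.1, lt_of_le_of_lt h1 ht.1, ht.2⟩⟩
    rw [Measure.restrict_congr_set hset, ← intervalIntegral.integral_of_le hjT,
      integral_inv_sq (hy.pos j) hjT]
    ring
  rw [Finset.sum_congr rfl hterm, Finset.sum_add_distrib, Finset.sum_const, nsmul_eq_mul,
    ← intervalIntegral.integral_finsetSum, countLE, Set.ncard_eq_toFinset_card _ (hy.finite T),
    div_eq_mul_inv]
  · congr 1
    refine intervalIntegral.integral_congr fun t ht => ?_
    rw [Set.uIcc_of_le hT] at ht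
    simp only [Set.indicator_apply, Set.mem_Ici]
    rw [← Finset.sum_filter, Finset.sum_const, nsmul_eq_mul, countLE,
      ← Set.ncard_coe_finset]
    congr 3
    ext j
    simp only [Finset.coe_filter, Set.Finite.mem_toFinset, Set.mem_ofPred_eq]
    exact ⟨fun h => h.2, fun h => ⟨h.trans ht.2, h⟩⟩
  · intro j _
    rw [intervalIntegrable_iff]
    exact ((intervalIntegrable_iff.1 (intervalIntegrable_inv_sq hT))).indicator measurableSet_Ici

/-- If `N(T) ~ C T (ln T)^a`, then `∑_{y_j ≤ T} 1 / y_j ~ C (ln T)^(a+1) / (a+1)`. -/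
theorem tendsto_sum_inv_div (hy : IsLocallyFiniteFamily y) {C : ℝ} {a : ℕ}
    (h : GrowsLike (countLE y) C a) :
    Tendsto (fun T => (∑ j ∈ (hy.finite T).toFinset, (y j)⁻¹) / Real.log T ^ (a + 1)) atTop
      (𝓝 (C / (a + 1))) := by
  have hlog : Tendsto (fun T : ℝ => (Real.log T)⁻¹) atTop (𝓝 0) :=
    Real.tendsto_log_atTop.inv_tendsto_atTop
  have hlogp : Tendsto (fun T : ℝ => (Real.log T ^ (a + 1))⁻¹) atTop (𝓝 0) :=
    ((tendsto_pow_atTop (Nat.succ_ne_zero a)).comp Real.tendsto_log_atTop).inv_tendsto_atTop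
  have hsmall : Tendsto (fun T => countLE y T / (T * Real.log T ^ a) * (Real.log T)⁻¹) atTop
      (𝓝 0) := by simpa using h.mul hlog
  refine tendsto_of_forall_abs_sub_le (M := 1)
    (g := fun T => countLE y T / (T * Real.log T ^ a) * (Real.log T)⁻¹ + C / (a + 1))
    (by simpa using hsmall.add_const (C / (a + 1))) fun ε hε => ?_
  obtain ⟨K, hK, hb⟩ := h.exists_abs_sub_le hy.countLE_mono (countLE_nonneg y) hε
  refine ⟨fun T => K * (Real.log T ^ (a + 1))⁻¹, by simpa using hlogp.const_mul K, ?_⟩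
  filter_upwards [eventually_ge_atTop (Real.exp 1)] with T hTe
  have hT : 1 ≤ T := (Real.one_le_exp zero_le_one).trans hTe
  have hL : 0 < Real.log T :=
    zero_lt_one.trans_le (by simpa using one_le_log_pow hTe 1)
  have hI := intervalIntegrable_log_pow_div hT a
  have hN := intervalIntegrable_mul_inv_sq hy.countLE_mono hT
  have hint : |(∫ t in (1 : ℝ)..T, countLE y t * (t ^ 2)⁻¹) -
      C * (Real.log T ^ (a + 1) / (a + 1))| ≤ ε * (Real.log T ^ (a + 1) / (a + 1)) + K := by
    rw [← integral_log_pow_div hT a, ← intervalIntegral.integral_const_mul,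
      ← intervalIntegral.integral_sub hN (hI.const_mul C), ← Real.norm_eq_abs,
      ← intervalIntegral.integral_const_mul]
    have hKK : K * (1⁻¹ - T⁻¹) ≤ K :=
      mul_le_of_le_one_right hK (by
        have : 0 ≤ T⁻¹ := by positivity
        simpa using this)
    rw [← integral_inv_sq one_pos hT, ← intervalIntegral.integral_const_mul] at hKK
    refine le_trans ?_ (add_le_add_right hKK _)
    rw [← intervalIntegral.integral_add (hI.const_mul ε)
      ((intervalIntegrable_inv_sq hT).const_mul K)]
    refine intervalIntegral.norm_integral_le_of_norm_le hT (Eventually.of_forall fun t ht => ?_)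
      ((hI.const_mul ε).add ((intervalIntegrable_inv_sq hT).const_mul K))
    have ht1 : 1 ≤ t := ht.1.le
    have ht0 : 0 < t := by linarith
    have h1 : countLE y t * (t ^ 2)⁻¹ - C * (Real.log t ^ a / t) =
        (countLE y t - C * (t * Real.log t ^ a)) * (t ^ 2)⁻¹ := by
      field_simp
    rw [h1, norm_mul, Real.norm_eq_abs, Real.norm_of_nonneg (by positivity : 0 ≤ (t ^ 2)⁻¹)]
    refine (mul_le_mul_of_nonneg_right (hb t ht1) (by positivity)).trans_eq ?_
    field_simp
  rw [sum_inv_eq hy hT]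
  have hP : 0 < Real.log T ^ (a + 1) := by positivity
  have ha : (0 : ℝ) < a + 1 := by positivity
  have e1 : (countLE y T / T + ∫ t in (1 : ℝ)..T, countLE y t * (t ^ 2)⁻¹) / Real.log T ^ (a + 1) -
      (countLE y T / (T * Real.log T ^ a) * (Real.log T)⁻¹ + C / (a + 1)) =
      ((∫ t in (1 : ℝ)..T, countLE y t * (t ^ 2)⁻¹) - C * (Real.log T ^ (a + 1) / (a + 1))) /
        Real.log T ^ (a + 1) := by
    field_simp
    ring
  rw [e1, abs_div, abs_of_pos hP, div_le_iff₀ hP]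
  refine hint.trans ?_
  have e2 : (ε * 1 + K * (Real.log T ^ (a + 1))⁻¹) * Real.log T ^ (a + 1) =
      ε * Real.log T ^ (a + 1) + K := by
    field_simp
  rw [e2]
  have : Real.log T ^ (a + 1) / (a + 1) ≤ Real.log T ^ (a + 1) :=
    div_le_self hP.le (by linarith [(Nat.cast_nonneg a : (0 : ℝ) ≤ a)])
  have := mul_le_mul_of_nonneg_left this hε.le
  linarith

end Abel

/-! ### Growth of the counting function of a product family -/

section Product

variable {ι κ : Type*} {x : ι → ℝ} {y : κ → ℝ}

/-- A factor of linear growth raises the power of the logarithm by one: the counting function of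
the product is `∑_{y_j ≤ T} n(T / y_j)`, where `n(t) = A t + o(t)` up to a bounded error, and
`∑_{y_j ≤ T} 1 / y_j ~ C (ln T)^(a+1) / (a+1)`. The bounded error adds up to a multiple of the
counting function of `y`, which is of lower order. -/
theorem GrowsLike.mul_linear (hx : IsLocallyFiniteFamily x) (hy : IsLocallyFiniteFamily y)
    {A C : ℝ} {a : ℕ} (hA : GrowsLike (countLE x) A 0) (hC : GrowsLike (countLE y) C a) :
    GrowsLike (countLE fun p : ι × κ => x p.1 * y p.2) (A * C / (a + 1)) (a + 1) := by
  set S : ℝ → ℝ := fun T => ∑ j ∈ (hy.finite T).toFinset, (y j)⁻¹ with hSdef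
  have hS : Tendsto (fun T => S T / Real.log T ^ (a + 1)) atTop (𝓝 (C / (a + 1))) :=
    tendsto_sum_inv_div hy hC
  have hsmall : Tendsto (fun T => countLE y T / (T * Real.log T ^ a) * (Real.log T)⁻¹) atTop
      (𝓝 0) := by simpa using Tendsto.mul hC Real.tendsto_log_atTop.inv_tendsto_atTop
  refine tendsto_of_forall_abs_sub_le (M := C / (a + 1) + 1)
    (g := fun T => A * (S T / Real.log T ^ (a + 1)))
    (by simpa [mul_div_assoc] using hS.const_mul A) fun ε hε => ?_
  obtain ⟨K, hK, hb⟩ := hA.exists_abs_sub_le hx.countLE_mono (countLE_nonneg x) hε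
  refine ⟨fun T => K * (countLE y T / (T * Real.log T ^ a) * (Real.log T)⁻¹),
    by simpa using hsmall.const_mul K, ?_⟩
  filter_upwards [eventually_ge_atTop (Real.exp 1),
    hS.eventually_le_const (lt_add_one (C / (a + 1)))] with T hTe hST
  have hT : 1 ≤ T := (Real.one_le_exp zero_le_one).trans hTe
  have hT0 : 0 < T := by linarith
  have hL : 0 < Real.log T :=
    zero_lt_one.trans_le (by simpa using one_le_log_pow hTe 1)
  have hmain : |countLE (fun p : ι × κ => x p.1 * y p.2) T - A * (T * S T)| ≤
      ε * (T * S T) + K * countLE y T := by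
    have e1 : A * (T * S T) = ∑ j ∈ (hy.finite T).toFinset, A * (T / y j) := by
      simp only [hSdef, Finset.mul_sum, div_eq_mul_inv]
    have e2 : ε * (T * S T) + K * countLE y T =
        ∑ j ∈ (hy.finite T).toFinset, (ε * (T / y j) + K) := by
      rw [Finset.sum_add_distrib, Finset.sum_const, nsmul_eq_mul, countLE,
        Set.ncard_eq_toFinset_card _ (hy.finite T), mul_comm K]
      simp only [hSdef, Finset.mul_sum, div_eq_mul_inv]
    rw [countLE_mul hx hy, e1, e2, ← Finset.sum_sub_distrib]
    refine (Finset.abs_sum_le_sum_abs _ _).trans (Finset.sum_le_sum fun j hj => ?_)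
    have hjT : y j ≤ T := by simpa using hj
    simpa using hb (T / y j) ((one_le_div (hy.pos j)).2 hjT)
  have hP : 0 < T * Real.log T ^ (a + 1) := by positivity
  have e3 : countLE (fun p : ι × κ => x p.1 * y p.2) T / (T * Real.log T ^ (a + 1)) -
      A * (S T / Real.log T ^ (a + 1)) =
      (countLE (fun p : ι × κ => x p.1 * y p.2) T - A * (T * S T)) /
        (T * Real.log T ^ (a + 1)) := by
    field_simp
  rw [e3, abs_div, abs_of_pos hP]
  calc _ ≤ (ε * (T * S T) + K * countLE y T) / (T * Real.log T ^ (a + 1)) := by gcongr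
    _ = ε * (S T / Real.log T ^ (a + 1)) +
        K * (countLE y T / (T * Real.log T ^ a) * (Real.log T)⁻¹) := by
      rw [pow_succ]
      field_simp
    _ ≤ _ := by gcongr

/-- A factor with `∑ 1 / x i = B < ∞` only multiplies the growth constant by `B`: the
counting function of the product is `∑ᵢ N(T / x i)`, and dominated convergence applies. -/
theorem GrowsLike.mul_summable (hx : IsLocallyFiniteFamily x) (hy : IsLocallyFiniteFamily y)
    {B C : ℝ} {a : ℕ} (hB : HasSum (fun i => (x i)⁻¹) B) (hC : GrowsLike (countLE y) C a) :
    GrowsLike (countLE fun p : ι × κ => x p.1 * y p.2) (C * B) a := by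
  obtain ⟨K, hK, hb⟩ := hC.exists_le hy.countLE_mono (countLE_nonneg y)
  have hsum : ∀ T, countLE (fun p : ι × κ => x p.1 * y p.2) T =
      ∑' i, countLE y (T / x i) := by
    intro T
    have hswap : (fun p : ι × κ => x p.1 * y p.2) ∘ Equiv.prodComm κ ι =
        fun p => y p.1 * x p.2 := funext fun p => mul_comm _ _
    rw [← countLE_comp_equiv _ (Equiv.prodComm κ ι), hswap, countLE_mul hy hx, tsum_eq_sum]
    intro i hi
    refine hy.countLE_eq_zero ((div_lt_one (hx.pos i)).2 ?_)
    simpa using hi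
  unfold GrowsLike
  simp_rw [hsum, ← tsum_div_const]
  rw [← (hB.mul_left C).tsum_eq]
  refine tendsto_tsum_of_dominated_convergence (bound := fun i => K * 2 ^ a * (x i)⁻¹)
    (hB.summable.mul_left _) (fun i => ?_) ?_
  · have hxi := hx.pos i
    have h1 : Tendsto (fun T : ℝ => T / x i) atTop atTop := tendsto_id.atTop_div_const hxi
    have h2 : Tendsto (fun T : ℝ => 1 - Real.log (x i) * (Real.log T)⁻¹) atTop (𝓝 1) := by
      simpa using (Real.tendsto_log_atTop.inv_tendsto_atTop.const_mul
        (Real.log (x i))).const_sub 1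
    have h3 := ((hC.comp h1).mul (h2.pow a)).mul_const (x i)⁻¹
    rw [one_pow, mul_one] at h3
    refine h3.congr' ?_
    filter_upwards [eventually_gt_atTop (x i)] with T hT
    have hT0 : 0 < T := hxi.trans hT
    have hl : 0 < Real.log (T / x i) := Real.log_pos ((one_lt_div hxi).2 hT)
    have hlT : 0 < Real.log T := Real.log_pos ((hx.one_le i).trans_lt hT)
    have e : 1 - Real.log (x i) * (Real.log T)⁻¹ = Real.log (T / x i) / Real.log T := by
      rw [Real.log_div hT0.ne' hxi.ne']
      field_simp
    rw [e, div_pow]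
    simp only [Function.comp_apply]
    field_simp
  · filter_upwards [eventually_ge_atTop (Real.exp 1)] with T hTe i
    have hT0 : 0 < T := (Real.exp_pos 1).trans_le hTe
    have hL : 1 ≤ Real.log T := by simpa using one_le_log_pow hTe 1
    have hxi := hx.pos i
    have hP : 0 < T * Real.log T ^ a := by positivity
    rw [Real.norm_of_nonneg (div_nonneg (countLE_nonneg _ _) hP.le), div_le_iff₀ hP]
    rcases lt_or_ge (T / x i) 1 with h | h
    · rw [hy.countLE_eq_zero h]
      positivity
    · refine (hb _ h).trans ?_
      have hl : 1 + Real.log (T / x i) ≤ 2 * Real.log T := by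
        have : Real.log (T / x i) ≤ Real.log T :=
          Real.log_le_log (by positivity) (div_le_self hT0.le (hx.one_le i))
        linarith
      have hl0 : 0 ≤ 1 + Real.log (T / x i) := by linarith [Real.log_nonneg h]
      calc K * (T / x i * (1 + Real.log (T / x i)) ^ a)
          ≤ K * (T / x i * (2 * Real.log T) ^ a) := by gcongr
        _ = _ := by rw [mul_pow]; field_simp

end Product

/-! ### Approximation numbers of the embedding -/

section Approx

variable {d : ℕ} {s : Fin d → ℝ} {q : Fin d → ℝ≥0∞}

theorem approxNumber_le {𝕜 X Y : Type*} [NontriviallyNormedField 𝕜]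
    [NormedAddCommGroup X] [NormedSpace 𝕜 X] [NormedAddCommGroup Y] [NormedSpace 𝕜 Y]
    (T A : X →L[𝕜] Y) {n : ℕ} (hA : LinearMap.rank (A : X →ₗ[𝕜] Y) < (n : Cardinal)) :
    approxNumber T n ≤ ‖T - A‖ :=
  csInf_le ⟨0, by rintro c ⟨A, -, rfl⟩; exact norm_nonneg _⟩ ⟨A, hA, rfl⟩

theorem le_approxNumber {𝕜 X Y : Type*} [NontriviallyNormedField 𝕜]
    [NormedAddCommGroup X] [NormedSpace 𝕜 X] [NormedAddCommGroup Y] [NormedSpace 𝕜 Y]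
    {T : X →L[𝕜] Y} {n : ℕ} (hn : 0 < n) {c : ℝ}
    (h : ∀ A : X →L[𝕜] Y, LinearMap.rank (A : X →ₗ[𝕜] Y) < (n : Cardinal) → c ≤ ‖T - A‖) :
    c ≤ approxNumber T n := by
  refine le_csInf ⟨‖T - 0‖, 0, ?_, rfl⟩ ?_
  · have : ((0 : X →L[𝕜] Y) : X →ₗ[𝕜] Y) = 0 := rfl
    rw [this, LinearMap.rank_zero]
    exact_mod_cast hn
  · rintro _ ⟨A, hA, rfl⟩
    exact h A hA

theorem embedding_apply (hs : ∀ j, 0 < s j) (f : SobolevSpace s q) :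
    embedding hs q f = SobolevSpace.toL2 s q f := rfl

theorem SobolevSpace.norm_sq (f : SobolevSpace s q) :
    ‖f‖ ^ 2 = ∑' k, ‖fourierCoef k (toL2 s q f)‖ ^ 2 * mixWeightSq s q k := by
  rw [norm_def, Real.sq_sqrt]
  exact tsum_nonneg fun k => mul_nonneg (sq_nonneg _) (mixWeightSq_pos s q k).le

theorem fourierCoef_torusBasis [DecidableEq (Fin d → ℤ)] (k l : Fin d → ℤ) :
    fourierCoef k (torusBasis d l) = if k = l then 1 else 0 := by
  rw [fourierCoef_eq_repr, HilbertBasis.repr_self, lp.single_apply, Pi.single_apply]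

/-- The Fourier coefficient `c_k` as a linear functional on `L₂`. -/
def fourierCoefₗ (k : Fin d → ℤ) : TorusL2 d →ₗ[ℂ] ℂ where
  toFun f := fourierCoef k f
  map_add' f g := fourierCoef_add f g k
  map_smul' c f := fourierCoef_smul c f k

/-- The orthogonal projection of `L₂` onto the span of the basis functions with frequencies in
`F`. -/
def fourierProj (F : Finset (Fin d → ℤ)) : TorusL2 d →L[ℂ] TorusL2 d :=
  ∑ k ∈ F, (innerSL ℂ (torusBasis d k)).smulRight (torusBasis d k)

theorem fourierProj_apply (F : Finset (Fin d → ℤ)) (f : TorusL2 d) :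
    fourierProj F f = ∑ k ∈ F, fourierCoef k f • torusBasis d k := by
  simp only [fourierProj, sum_apply, ContinuousLinearMap.smulRight_apply,
    innerSL_apply_apply, fourierCoef_eq_repr, HilbertBasis.repr_apply_apply]

theorem fourierCoef_sum_smul [DecidableEq (Fin d → ℤ)] (F : Finset (Fin d → ℤ))
    (c : (Fin d → ℤ) → ℂ) (k : Fin d → ℤ) :
    fourierCoef k ⇑(∑ l ∈ F, c l • torusBasis d l) = if k ∈ F then c k else 0 := by
  have h : fourierCoefₗ k (∑ l ∈ F, c l • torusBasis d l) =
      ∑ l ∈ F, c l * fourierCoef k (torusBasis d l) := by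
    rw [map_sum]
    exact Finset.sum_congr rfl fun l _ => fourierCoef_smul _ _ _
  change fourierCoefₗ k _ = _
  rw [h]
  simp [fourierCoef_torusBasis]

theorem fourierCoef_sub_fourierProj [DecidableEq (Fin d → ℤ)] (F : Finset (Fin d → ℤ))
    (f : TorusL2 d) (k : Fin d → ℤ) :
    fourierCoef k ⇑(f - fourierProj F f) = if k ∈ F then 0 else fourierCoef k f := by
  change fourierCoefₗ k (f - fourierProj F f) = _
  rw [map_sub, fourierProj_apply]
  change fourierCoef k f - fourierCoef k _ = _
  rw [fourierCoef_sum_smul]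
  split_ifs <;> simp

theorem rank_fourierProj_comp_le {X : Type*} [AddCommGroup X] [Module ℂ X]
    (F : Finset (Fin d → ℤ)) (g : X →ₗ[ℂ] TorusL2 d) :
    LinearMap.rank ((fourierProj F : TorusL2 d →ₗ[ℂ] TorusL2 d) ∘ₗ g) ≤ F.card := by
  classical
  have hle : LinearMap.range ((fourierProj F : TorusL2 d →ₗ[ℂ] TorusL2 d) ∘ₗ g) ≤
      Submodule.span ℂ (F.image (torusBasis d) : Set (TorusL2 d)) := by
    rintro _ ⟨f, rfl⟩
    simp only [LinearMap.comp_apply, ContinuousLinearMap.coe_coe, fourierProj_apply]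
    exact Submodule.sum_mem _ fun k hk => Submodule.smul_mem _ _
      (Submodule.subset_span (by simpa using ⟨k, hk, rfl⟩))
  refine (Submodule.rank_mono hle).trans ((rank_span_finset_le _).trans ?_)
  exact_mod_cast Finset.card_image_le

/-- Upper bound: truncating the Fourier series to the frequencies of small weight. -/
theorem approxNumber_embedding_le (hs : ∀ j, 0 < s j) {F : Finset (Fin d → ℤ)} {n : ℕ}
    (hF : F.card < n) {V : ℝ} (hV : 0 < V) (h : ∀ k ∉ F, V ^ 2 ≤ mixWeightSq s q k) :
    approxNumber (embedding hs q) n ≤ V⁻¹ := by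
  classical
  refine (approxNumber_le _ ((fourierProj F).comp (embedding hs q)) ?_).trans ?_
  · exact (rank_fourierProj_comp_le F (embedding hs q : SobolevSpace s q →ₗ[ℂ] TorusL2 d)).trans_lt
      (by exact_mod_cast hF)
  · refine ContinuousLinearMap.opNorm_le_bound _ (by positivity) fun f => ?_
    rw [sub_apply, ContinuousLinearMap.comp_apply, embedding_apply]
    refine abs_le_of_sq_le_sq' ?_ (by positivity) |>.2
    rw [mul_pow, SobolevSpace.norm_sq, ← tsum_mul_left]
    refine hasSum_le (fun k => ?_) (hasSum_sq_fourierCoef _)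
      ((SobolevSpace.summable s q f).mul_left _).hasSum
    rw [fourierCoef_sub_fourierProj]
    have hw := (mixWeightSq_pos s q k).le
    split_ifs with hk
    · rw [norm_zero, zero_pow two_ne_zero]
      positivity
    · have h1 : 1 ≤ V⁻¹ ^ 2 * mixWeightSq s q k := by
        rw [inv_pow, inv_mul_eq_div, one_le_div (by positivity)]
        exact h k hk
      nlinarith [sq_nonneg ‖fourierCoef k (SobolevSpace.toL2 s q f)‖]

theorem mem_sobolevSubmodule_sum (F : Finset (Fin d → ℤ)) (c : (Fin d → ℤ) → ℂ) :
    ∑ l ∈ F, c l • torusBasis d l ∈ sobolevSubmodule s q := by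
  classical
  change Summable _
  refine summable_of_ne_finset_zero (s := F) fun k hk => ?_
  rw [fourierCoef_sum_smul, if_neg hk]
  simp

/-- The trigonometric polynomial with coefficients `c` and frequencies in `F`, as an element of the
Sobolev space. -/
def trigSum (s : Fin d → ℝ) (q : Fin d → ℝ≥0∞) (F : Finset (Fin d → ℤ)) :
    (F → ℂ) →ₗ[ℂ] SobolevSpace s q :=
  LinearMap.codRestrict (sobolevSubmodule s q)
    (Fintype.linearCombination ℂ (fun l : F => torusBasis d l)) fun c => by
      rw [Fintype.linearCombination_apply]
      exact Submodule.sum_mem _ fun l _ => Submodule.smul_mem _ _ (by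
        simpa using mem_sobolevSubmodule_sum {(l : Fin d → ℤ)} (fun _ => (1 : ℂ)))

theorem toL2_trigSum (F : Finset (Fin d → ℤ)) (c : F → ℂ) :
    SobolevSpace.toL2 s q (trigSum s q F c) = ∑ l, c l • torusBasis d l := rfl

theorem fourierCoef_trigSum_of_notMem (F : Finset (Fin d → ℤ)) (c : F → ℂ) {k : Fin d → ℤ}
    (hk : k ∉ F) : fourierCoef k (SobolevSpace.toL2 s q (trigSum s q F c)) = 0 := by
  classical
  rw [toL2_trigSum]
  change fourierCoefₗ k _ = _
  rw [map_sum]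
  refine Finset.sum_eq_zero fun l _ => ?_
  rw [map_smul]
  change c l • fourierCoef k (torusBasis d l) = 0
  have hkl : k ≠ l := fun h => hk (h ▸ l.2)
  rw [fourierCoef_torusBasis, if_neg hkl, smul_zero]

theorem trigSum_injective (F : Finset (Fin d → ℤ)) :
    Function.Injective (trigSum s q F) := by
  have h : LinearIndependent ℂ (fun l : F => torusBasis d l) :=
    (torusBasis d).orthonormal.linearIndependent.comp _ Subtype.val_injective
  intro c c' hcc
  have h1 := congrArg (SobolevSpace.toL2 s q) hcc
  exact linearIndependent_iff_injective_fintypeLinearCombination.1 h h1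

/-- Lower bound: on the span of at least `n` basis functions of small weight an operator of rank
`< n` has a nontrivial kernel. -/
theorem le_approxNumber_embedding (hs : ∀ j, 0 < s j) {F : Finset (Fin d → ℤ)} {n : ℕ}
    (hn : 0 < n) (hF : n ≤ F.card) {V : ℝ} (hV : 0 < V)
    (h : ∀ k ∈ F, mixWeightSq s q k ≤ V ^ 2) :
    V⁻¹ ≤ approxNumber (embedding hs q) n := by
  refine le_approxNumber hn fun A hA => ?_
  obtain ⟨c, hc, hc0⟩ : ∃ c : F → ℂ, A (trigSum s q F c) = 0 ∧ c ≠ 0 := by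
    by_contra! hcon
    have hinj : LinearMap.ker ((A : SobolevSpace s q →ₗ[ℂ] TorusL2 d) ∘ₗ trigSum s q F) = ⊥ :=
      LinearMap.ker_eq_bot'.2 hcon
    have h1 : LinearMap.rank ((A : SobolevSpace s q →ₗ[ℂ] TorusL2 d) ∘ₗ trigSum s q F) < n :=
      (LinearMap.rank_comp_le_left _ _).trans_lt hA
    have h2 := LinearEquiv.lift_rank_eq (LinearEquiv.ofInjective _ (LinearMap.ker_eq_bot.1 hinj))
    have h3 : Module.rank ℂ (F → ℂ) = F.card := by simp
    unfold LinearMap.rank at h1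
    rw [h3, Cardinal.lift_natCast, Cardinal.lift_id'] at h2
    rw [← h2] at h1
    exact absurd hF (not_le.2 (by exact_mod_cast h1))
  set f := trigSum s q F c with hf
  have hf0 : 0 < ‖f‖ := norm_pos_iff.2 fun h0 =>
    hc0 (trigSum_injective F (by rw [← hf, h0, map_zero]))
  have h1 : ‖f‖ ≤ V * ‖SobolevSpace.toL2 s q f‖ := by
    refine abs_le_of_sq_le_sq' ?_ (by positivity) |>.2
    rw [mul_pow, SobolevSpace.norm_sq]
    refine hasSum_le (fun k => ?_) (SobolevSpace.summable s q f).hasSum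
      ((hasSum_sq_fourierCoef _).mul_left _)
    by_cases hk : k ∈ F
    · rw [mul_comm]
      exact mul_le_mul_of_nonneg_right (h k hk) (sq_nonneg _)
    · rw [hf, fourierCoef_trigSum_of_notMem F c hk]
      simp
  have h2 : ‖SobolevSpace.toL2 s q f‖ ≤ ‖embedding hs q - A‖ * ‖f‖ := by
    have := (embedding hs q - A).le_opNorm f
    rwa [sub_apply, hc, sub_zero, embedding_apply] at this
  rw [inv_le_iff_one_le_mul₀ hV]
  have h3 : ‖f‖ ≤ (‖embedding hs q - A‖ * V) * ‖f‖ := by nlinarith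
  exact (le_mul_iff_one_le_left hf0).1 h3

end Approx

/-! ### The univariate weights -/

section Weight

variable {q : ℝ≥0∞}

theorem weight_neg (q : ℝ≥0∞) (t : ℝ) (m : ℤ) : weight q (-t) m = (weight q t m)⁻¹ := by
  unfold weight
  split_ifs
  · rw [Real.rpow_neg (by positivity)]
  · rw [neg_div, Real.rpow_neg (by positivity)]

theorem weight_neg_index (q : ℝ≥0∞) (t : ℝ) (m : ℤ) : weight q t (-m) = weight q t m := by
  simp [weight]

theorem weight_rpow (q : ℝ≥0∞) (t a : ℝ) (m : ℤ) : weight q t m ^ a = weight q (t * a) m := by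
  unfold weight
  split_ifs
  · rw [← Real.rpow_mul (by positivity)]
  · rw [← Real.rpow_mul (by positivity), div_mul_eq_mul_div]

theorem weight_zero (hq : 0 < q) (t : ℝ) : weight q t 0 = 1 := by
  unfold weight
  split_ifs with h
  · simp
  · simp [Real.zero_rpow (ENNReal.toReal_pos hq.ne' h).ne']

theorem abs_le_weight_one (hq : 0 < q) (m : ℤ) : |(m : ℝ)| ≤ weight q 1 m := by
  unfold weight
  split_ifs with h
  · simp
  · have hq' := ENNReal.toReal_pos hq.ne' h
    calc |(m : ℝ)| = (|(m : ℝ)| ^ q.toReal) ^ (1 / q.toReal) := by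
          rw [← Real.rpow_mul (abs_nonneg _), mul_one_div_cancel hq'.ne', Real.rpow_one]
      _ ≤ _ := by gcongr; linarith

theorem isLocallyFiniteFamily_weight (hq : 0 < q) {r : ℝ} (hr : 1 ≤ r) :
    IsLocallyFiniteFamily (weight q r) where
  one_le := one_le_weight q (by linarith)
  finite T := by
    refine (Set.finite_Icc (-⌊T⌋) ⌊T⌋).subset fun m hm => ?_
    have h1 : weight q 1 m ≤ weight q r m := by
      have := Real.rpow_le_rpow_of_exponent_le (one_le_weight q zero_le_one m) hr
      rwa [Real.rpow_one, weight_rpow, one_mul] at this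
    have h2 := abs_le.1 (((abs_le_weight_one hq m).trans h1).trans hm)
    refine ⟨neg_le.1 (Int.le_floor.2 ?_), Int.le_floor.2 h2.2⟩
    push_cast
    linarith [h2.1]

theorem summable_termB (hq : 0 < q) {r : ℝ} (hr : 1 < r) : Summable (termB q r) := by
  have h := (summable_nat_add_iff 1).2 (Real.summable_nat_rpow_inv.2 hr)
  refine Summable.of_nonneg_of_le (fun m => (weight_pos _ _ _).le) (fun m => ?_) h
  unfold termB
  rw [weight_neg]
  refine inv_anti₀ (by positivity) ?_
  have h1 := Real.rpow_le_rpow (abs_nonneg _) (abs_le_weight_one hq ((m : ℤ) + 1))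
    (by linarith : 0 ≤ r)
  rw [weight_rpow, one_mul] at h1
  refine le_trans (le_of_eq ?_) h1
  push_cast
  rw [abs_of_nonneg (by positivity)]

theorem constB_pos (q : ℝ≥0∞) (r : ℝ) : 0 < constB q r := by
  have : 0 ≤ ∑' m : ℕ, termB q r m := tsum_nonneg fun m => (weight_pos _ _ _).le
  unfold constB
  linarith

/-- `constB` is the sum of the reciprocal weights over all of `ℤ`. -/
theorem hasSum_inv_weight (hq : 0 < q) {r : ℝ} (hr : 1 < r) :
    HasSum (fun m : ℤ => (weight q r m)⁻¹) (constB q r) := by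
  have h := (summable_termB hq hr).hasSum
  have h1 : HasSum (fun n : ℕ => (weight q r ((n : ℤ) + 1))⁻¹) (∑' m, termB q r m) := by
    have e : (fun n : ℕ => (weight q r ((n : ℤ) + 1))⁻¹) = termB q r :=
      funext fun n => (weight_neg q r _).symm
    rwa [e]
  have h2 : HasSum (fun n : ℕ => (weight q r (-((n : ℤ) + 1)))⁻¹) (∑' m, termB q r m) := by
    simpa only [weight_neg_index] using h1
  have h3 : HasSum (fun n : ℕ => (weight q r (n : ℤ))⁻¹) (∑' m, termB q r m + 1) := by
    have := (hasSum_nat_add_iff (f := fun n : ℕ => (weight q r (n : ℤ))⁻¹) 1).1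
      (by simpa using h1)
    simpa [weight_zero hq] using this
  have e : constB q r = ∑' m, termB q r m + 1 + ∑' m, termB q r m := by
    rw [constB]
    ring
  rw [e]
  exact HasSum.of_nat_of_neg_add_one h3 h2

theorem ncard_abs_le {R : ℝ} (hR : 0 ≤ R) :
    ({m : ℤ | |(m : ℝ)| ≤ R}.ncard : ℝ) = 2 * (⌊R⌋₊ : ℝ) + 1 := by
  have h : {m : ℤ | |(m : ℝ)| ≤ R} = ↑(Finset.Icc (-(⌊R⌋₊ : ℤ)) ⌊R⌋₊) := by
    ext m
    rw [Finset.coe_Icc, Set.mem_Icc, ← abs_le, Set.mem_ofPred_eq, ← Int.natCast_natAbs,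
      Nat.cast_le, Nat.le_floor_iff hR, Nat.cast_natAbs, Int.cast_abs]
  rw [h, Set.ncard_coe_finset, Int.card_Icc]
  have : (⌊R⌋₊ + 1 - -(⌊R⌋₊ : ℤ)).toNat = 2 * ⌊R⌋₊ + 1 := by omega
  rw [this]
  push_cast
  ring

/-- If `x m ≤ T` means `|m| ≤ R(T)` with `R(T) ~ T`, then `x` has linear growth with constant `2`. -/
theorem growsLike_of_le_iff_abs_le {x : ℤ → ℝ} {R : ℝ → ℝ}
    (hR : Tendsto (fun T => R T / T) atTop (𝓝 1))
    (h : ∀ᶠ T in atTop, ∀ m, x m ≤ T ↔ |(m : ℝ)| ≤ R T) : GrowsLike (countLE x) 2 0 := by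
  have hRtop : Tendsto R atTop atTop := by
    refine (hR.pos_mul_atTop one_pos tendsto_id).congr' ?_
    filter_upwards [eventually_gt_atTop 0] with T hT
    exact div_mul_cancel₀ _ hT.ne'
  have h1 : Tendsto (fun T => 2 * ((⌊R T⌋₊ : ℝ) / R T * (R T / T)) + T⁻¹) atTop (𝓝 2) := by
    simpa using (((tendsto_nat_floor_div_atTop.comp hRtop).mul hR).const_mul 2).add
      tendsto_inv_atTop_zero
  refine h1.congr' ?_
  filter_upwards [h, eventually_gt_atTop 0, hRtop.eventually_gt_atTop 0] with T hT hT0 hRT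
  simp only [countLE, hT, ncard_abs_le hRT.le, pow_zero, mul_one]
  field_simp

theorem growsLike_weight_one (hq : 0 < q) : GrowsLike (countLE (weight q 1)) 2 0 := by
  by_cases h : q = ∞
  · refine growsLike_of_le_iff_abs_le (R := id) ?_ ?_
    · refine tendsto_const_nhds.congr' ?_
      filter_upwards [eventually_gt_atTop 0] with T hT
      exact (div_self hT.ne').symm
    · filter_upwards [eventually_ge_atTop 1] with T hT m
      simp [weight, h, hT]
  · have hq' := ENNReal.toReal_pos hq.ne' h
    refine growsLike_of_le_iff_abs_le (R := fun T => (T ^ q.toReal - 1) ^ (1 / q.toReal)) ?_ ?_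
    · have h1 : Tendsto (fun T : ℝ => (1 - T ^ (-q.toReal)) ^ (1 / q.toReal)) atTop (𝓝 1) := by
        have := ((tendsto_rpow_neg_atTop hq').const_sub 1).rpow_const (p := 1 / q.toReal)
          (Or.inr (by positivity))
        simpa using this
      refine h1.congr' ?_
      filter_upwards [eventually_ge_atTop 1] with T hT
      have hT0 : 0 < T := by linarith
      have hTq : 1 ≤ T ^ q.toReal := Real.one_le_rpow hT hq'.le
      have e : T = (T ^ q.toReal) ^ (1 / q.toReal) := by
        rw [← Real.rpow_mul hT0.le, mul_one_div_cancel hq'.ne', Real.rpow_one]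
      conv_rhs => rw [e]
      rw [← Real.rpow_mul hT0.le (q.toReal) (1 / q.toReal), mul_one_div_cancel hq'.ne',
        Real.rpow_one]
      conv_rhs => enter [2]; rw [e]
      rw [← Real.div_rpow (by linarith) (by linarith), sub_div, div_self (by linarith),
        Real.rpow_neg hT0.le, one_div]
      simp
    · filter_upwards [eventually_ge_atTop 1] with T hT m
      have hT0 : 0 < T := by linarith
      have hTq : 1 ≤ T ^ q.toReal := Real.one_le_rpow hT hq'.le
      rw [weight, if_neg h, one_div, Real.rpow_inv_le_iff_of_pos (by positivity) hT0.le hq',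
        Real.le_rpow_inv_iff_of_pos (abs_nonneg _) (by linarith) hq']
      constructor <;> intro h <;> linarith

end Weight

/-! ### Counting the products of weights -/

/-- The number of `k` with `∏ⱼ weight (q j) (r j) (k j) ≤ T` when `r j = 1` for the first `ν`
coordinates and `r j > 1` for the others. Coordinates are added one at a time: each of the first
`ν` contributes a logarithm, each of the others the factor `constB (q j) (r j)`. -/
theorem growsLike_prod_weight {ν : ℕ} (hν : 1 ≤ ν) (m : ℕ) (q : Fin (m + 1) → ℝ≥0∞)
    (hq : ∀ j, 0 < q j) (r : Fin (m + 1) → ℝ) (hr1 : ∀ j : Fin (m + 1), (j : ℕ) < ν → r j = 1)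
    (hr2 : ∀ j : Fin (m + 1), ν ≤ (j : ℕ) → 1 < r j) :
    IsLocallyFiniteFamily (fun k : Fin (m + 1) → ℤ => ∏ j, weight (q j) (r j) (k j)) ∧
    GrowsLike (countLE fun k : Fin (m + 1) → ℤ => ∏ j, weight (q j) (r j) (k j))
      (2 ^ min ν (m + 1) / ((min ν (m + 1) - 1).factorial : ℝ) *
        ∏ j : Fin (m + 1), if ν ≤ (j : ℕ) then constB (q j) (r j) else 1)
      (min ν (m + 1) - 1) := by
  have hr : ∀ j, 1 ≤ r j := fun j =>
    (lt_or_ge (j : ℕ) ν).elim (fun h => (hr1 j h).ge) fun h => (hr2 j h).le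
  induction m with
  | zero =>
    have e : (fun k : Fin (0 + 1) → ℤ => ∏ j, weight (q j) (r j) (k j)) =
        weight (q 0) (r 0) ∘ Equiv.funUnique (Fin 1) ℤ := by
      funext k
      simp
    have hmin : min ν 1 = 1 := min_eq_right hν
    rw [e]
    refine ⟨(isLocallyFiniteFamily_weight (hq 0) (hr 0)).comp_equiv _, ?_⟩
    have h0 : r 0 = 1 := hr1 0 hν
    have hν0 : ν ≠ 0 := by omega
    simp only [GrowsLike, countLE_comp_equiv]
    simpa [h0, hmin, GrowsLike, hν0] using growsLike_weight_one (hq 0)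
  | succ m ih =>
    obtain ⟨ih1, ih2⟩ := ih (fun j => q j.castSucc) (fun j => hq _) (fun j => r j.castSucc)
      (fun j hj => hr1 _ hj) (fun j hj => hr2 _ hj) (fun j => hr _)
    set l : Fin (m + 1 + 1) := Fin.last (m + 1) with hl
    have hw := isLocallyFiniteFamily_weight (hq l) (hr l)
    have e : (fun k : Fin (m + 1 + 1) → ℤ => ∏ j, weight (q j) (r j) (k j)) =
        (fun p : ℤ × (Fin (m + 1) → ℤ) => weight (q l) (r l) p.1 *
          ∏ j : Fin (m + 1), weight (q j.castSucc) (r j.castSucc) (p.2 j)) ∘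
          (Fin.snocEquiv fun _ => ℤ).symm := by
      funext k
      rw [Fin.prod_univ_castSucc, mul_comm]
      rfl
    rw [e]
    refine ⟨(hw.mul ih1).comp_equiv _, ?_⟩
    simp only [GrowsLike, countLE_comp_equiv]
    rw [Fin.prod_univ_castSucc]
    simp only [Fin.val_castSucc, Fin.val_last]
    rcases lt_or_ge (m + 1) ν with h | h
    · have hx : GrowsLike (countLE (weight (q l) (r l))) 2 0 := by
        rw [hr1 l h]
        exact growsLike_weight_one (hq l)
      have := hx.mul_linear hw ih1 ih2
      rw [min_eq_right h.le] at this
      rw [min_eq_right (by omega : m + 1 + 1 ≤ ν), if_neg (by omega)]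
      refine cast (congrArg (fun c => GrowsLike _ c (m + 1)) ?_) this
      simp only [Nat.add_sub_cancel, Nat.factorial_succ]
      push_cast
      field_simp
      ring
    · have := ih2.mul_summable hw ih1 (hasSum_inv_weight (hq l) (hr2 l h))
      rw [min_eq_left h] at this
      rw [min_eq_left (by omega : ν ≤ m + 1 + 1), if_pos h, ← mul_assoc]
      exact this

/-! ### Inverting the asymptotics -/

/-- At the scale `T = n / (u (ln n)^b)` a function `N(T) ~ C T (ln T)^b` takes values `~ (C / u) n`,
because `ln T ~ ln n`. -/
theorem GrowsLike.tendsto_div_natCast {N : ℝ → ℝ} {C : ℝ} {b : ℕ} (hN : GrowsLike N C b) {u : ℝ}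
    (hu : 0 < u) :
    Tendsto (fun n : ℕ => N (n / (u * Real.log n ^ b)) / n) atTop (𝓝 (C / u)) := by
  have hlogn : Tendsto (fun n : ℕ => Real.log n) atTop atTop :=
    Real.tendsto_log_atTop.comp tendsto_natCast_atTop_atTop
  have hT : Tendsto (fun n : ℕ => (n : ℝ) / (u * Real.log n ^ b)) atTop atTop := by
    have h0 : Tendsto (fun n : ℕ => Real.log n ^ b / (n : ℝ)) atTop (𝓝[>] 0) := by
      refine tendsto_nhdsWithin_iff.2
        ⟨(Real.isLittleO_pow_log_id_atTop (n := b)).tendsto_div_nhds_zero.comp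
          tendsto_natCast_atTop_atTop, ?_⟩
      filter_upwards [hlogn.eventually_gt_atTop 0, eventually_gt_atTop 0] with n hn hn0
      have : (0 : ℝ) < n := by exact_mod_cast hn0
      exact div_pos (pow_pos hn b) this
    refine (h0.inv_tendsto_nhdsGT_zero.const_mul_atTop (inv_pos.2 hu)).congr fun n => ?_
    simp only [Pi.inv_apply, inv_div]
    rw [mul_comm u, ← div_div, div_eq_mul_inv _ u, mul_comm]
  have hlog : Tendsto (fun n : ℕ => Real.log (n / (u * Real.log n ^ b)) / Real.log n) atTop
      (𝓝 1) := by
    have h1 : Tendsto (fun n : ℕ => Real.log (Real.log n) / Real.log n) atTop (𝓝 0) :=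
      Real.isLittleO_log_id_atTop.tendsto_div_nhds_zero.comp hlogn
    have h2 : Tendsto (fun n : ℕ => Real.log u * (Real.log n)⁻¹) atTop (𝓝 0) := by
      simpa using hlogn.inv_tendsto_atTop.const_mul (Real.log u)
    have h3 : Tendsto (fun n : ℕ => 1 - (Real.log u * (Real.log n)⁻¹ +
        b * (Real.log (Real.log n) / Real.log n))) atTop (𝓝 1) := by
      simpa using (h2.add (h1.const_mul (b : ℝ))).const_sub 1
    refine h3.congr' ?_
    filter_upwards [hlogn.eventually_gt_atTop 0, eventually_gt_atTop 0] with n hn hn0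
    have hn' : (n : ℝ) ≠ 0 := by exact_mod_cast hn0.ne'
    rw [Real.log_div hn' (by positivity), Real.log_mul hu.ne' (by positivity), Real.log_pow]
    field_simp
  have h := ((hN.comp hT).mul (hlog.pow b)).mul_const u⁻¹
  rw [one_pow, mul_one, ← div_eq_mul_inv] at h
  refine h.congr' ?_
  filter_upwards [hlogn.eventually_gt_atTop 0, eventually_gt_atTop 0,
    (Real.tendsto_log_atTop.comp hT).eventually_gt_atTop 0] with n hn hn0 hl
  have hn' : (0 : ℝ) < n := by exact_mod_cast hn0
  simp only [Function.comp_apply] at hl ⊢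
  set L := Real.log (n / (u * Real.log n ^ b)) with hL
  rw [div_pow]
  generalize N (n / (u * Real.log n ^ b)) = z
  field_simp

/-- If `N(T) ~ C T (ln T)^b`, and `T ^ (-σ)` is a lower bound of `a n` as soon as `N(T) ≥ n` and an
upper bound as long as `N(T) < n`, then `a n ~ (C (ln n)^b / n) ^ σ`. -/
theorem GrowsLike.tendsto_rpow_mul {N : ℝ → ℝ} {C : ℝ} {b : ℕ} (hN : GrowsLike N C b)
    (hC : 0 < C) {σ : ℝ} {a : ℕ → ℝ}
    (hlow : ∀ (n : ℕ) (T : ℝ), 0 < n → 0 < T → n ≤ N T → (T ^ σ)⁻¹ ≤ a n)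
    (hup : ∀ (n : ℕ) (T : ℝ), 0 < T → N T < n → a n ≤ (T ^ σ)⁻¹) :
    Tendsto (fun n : ℕ => (n : ℝ) ^ σ * a n / Real.log n ^ ((b : ℝ) * σ)) atTop (𝓝 (C ^ σ)) := by
  have hlogn : Tendsto (fun n : ℕ => Real.log n) atTop atTop :=
    Real.tendsto_log_atTop.comp tendsto_natCast_atTop_atTop
  have hcont : ContinuousAt (fun u : ℝ => u ^ σ) C :=
    Real.continuousAt_rpow_const _ _ (Or.inl hC.ne')
  have key : ∀ {u : ℝ} {n : ℕ}, 0 < u → 0 < n → 0 < Real.log n →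
      (((n : ℝ) / (u * Real.log n ^ b)) ^ σ)⁻¹ =
        u ^ σ * (Real.log n ^ ((b : ℝ) * σ) / (n : ℝ) ^ σ) := by
    intro u n hu hn hl
    have hn' : (0 : ℝ) < n := by exact_mod_cast hn
    rw [Real.div_rpow hn'.le (by positivity), inv_div, Real.mul_rpow hu.le (by positivity),
      Real.rpow_mul hl.le, Real.rpow_natCast, mul_div_assoc]
  rw [tendsto_order]
  constructor
  -- For `u < C` close to `C`, the counting function exceeds `n` at `T = n / (u (ln n)^b)`.
  · intro v hv
    obtain ⟨u, huv, hu0, huC⟩ :=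
      (((hcont.tendsto.mono_left nhdsWithin_le_nhds).eventually_const_lt hv).and
        (Ioo_mem_nhdsLT hC)).exists
    have h1 : 1 < C / u := (one_lt_div hu0).2 huC
    filter_upwards [(hN.tendsto_div_natCast hu0).eventually_const_lt h1,
      hlogn.eventually_gt_atTop 0, eventually_gt_atTop 0] with n hn hl hn0
    have hn' : (0 : ℝ) < n := by exact_mod_cast hn0
    rw [one_lt_div hn'] at hn
    have h2 := hlow n _ hn0 (by positivity) hn.le
    rw [key hu0 hn0 hl] at h2
    refine huv.trans_le ?_
    rw [le_div_iff₀ (by positivity)]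
    rw [← mul_div_assoc, div_le_iff₀ (by positivity)] at h2
    linarith
  -- For `u > C` it stays below `n` there.
  · intro v hv
    obtain ⟨u, huv, huC⟩ :=
      (((hcont.tendsto.mono_left nhdsWithin_le_nhds).eventually_lt_const hv).and
        (self_mem_nhdsWithin : Set.Ioi C ∈ 𝓝[>] C)).exists
    have hu0 : 0 < u := hC.trans huC
    have h1 : C / u < 1 := (div_lt_one hu0).2 huC
    filter_upwards [(hN.tendsto_div_natCast hu0).eventually_lt_const h1,
      hlogn.eventually_gt_atTop 0, eventually_gt_atTop 0] with n hn hl hn0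
    have hn' : (0 : ℝ) < n := by exact_mod_cast hn0
    rw [div_lt_one hn'] at hn
    have h2 := hup n _ (by positivity) hn
    rw [key hu0 hn0 hl] at h2
    refine lt_of_le_of_lt ?_ huv
    rw [div_le_iff₀ (by positivity)]
    rw [← mul_div_assoc, le_div_iff₀ (by positivity)] at h2
    linarith

theorem mixWeightSq_eq_rpow {d : ℕ} (s : Fin d → ℝ) (q : Fin d → ℝ≥0∞) {s₁ : ℝ} (hs₁ : s₁ ≠ 0)
    (k : Fin d → ℤ) :
    mixWeightSq s q k = (∏ j, weight (q j) (s j / s₁) (k j)) ^ (2 * s₁) := by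
  rw [mixWeightSq, ← Real.finsetProd_rpow _ _ fun j _ => (weight_pos _ _ _).le]
  refine Finset.prod_congr rfl fun j _ => ?_
  rw [weight_rpow]
  congr 1
  field_simp

end MixedSobolev

end

theorem theorem3p4 (d ν : ℕ) (hd : 2 ≤ d) (hν : 1 ≤ ν) (hνd : ν < d)
    (q : Fin d → ℝ≥0∞) (hq : ∀ j, 0 < q j)
    (s : Fin d → ℝ) (hs : ∀ j, 0 < s j) (s₁ : ℝ)
    (hs_eq : ∀ j : Fin d, (j : ℕ) < ν → s j = s₁)
    (hs_lt : ∀ j : Fin d, ν ≤ (j : ℕ) → s₁ < s j)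
    (hs_mono : Monotone s) :
    (∀ j : Fin d, ν ≤ (j : ℕ) → Summable (MixedSobolev.termB (q j) (s j / s₁))) ∧
    Tendsto
      (fun n : ℕ => (n : ℝ) ^ s₁ * approxNumber (MixedSobolev.embedding hs q) n
        / (Real.log n) ^ (((ν : ℝ) - 1) * s₁))
      atTop
      (𝓝 ((2 ^ ν / ((ν - 1).factorial : ℝ)
        * ∏ j ∈ Finset.univ.filter (fun j : Fin d => ν ≤ (j : ℕ)),
             MixedSobolev.constB (q j) (s j / s₁)) ^ s₁)) := by
  have hs₁ : 0 < s₁ := hs_eq ⟨0, by omega⟩ hν ▸ hs _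
  have hr2 : ∀ j : Fin d, ν ≤ (j : ℕ) → 1 < s j / s₁ := fun j hj =>
    (one_lt_div hs₁).2 (hs_lt j hj)
  have hr1 : ∀ j : Fin d, (j : ℕ) < ν → s j / s₁ = 1 := fun j hj => by
    rw [hs_eq j hj, div_self hs₁.ne']
  refine ⟨fun j hj => MixedSobolev.summable_termB (hq j) (hr2 j hj), ?_⟩
  obtain ⟨m, rfl⟩ : ∃ m, d = m + 1 := ⟨d - 1, by omega⟩
  obtain ⟨hfin, hgrow⟩ :=
    MixedSobolev.growsLike_prod_weight hν m q hq (fun j => s j / s₁) hr1 hr2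
  set P : (Fin (m + 1) → ℤ) → ℝ := fun k => ∏ j, MixedSobolev.weight (q j) (s j / s₁) (k j)
    with hP
  have hsq : ∀ {T : ℝ}, 0 < T → (T ^ s₁) ^ 2 = T ^ (2 * s₁) := fun hT => by
    rw [← Real.rpow_natCast, ← Real.rpow_mul hT.le, mul_comm]
    norm_num
  have hcard : ∀ T, MixedSobolev.countLE P T = ((hfin.finite T).toFinset.card : ℝ) := fun T => by
    rw [MixedSobolev.countLE, Set.ncard_eq_toFinset_card _ (hfin.finite T)]
  rw [Finset.prod_filter]
  rw [min_eq_left hνd.le] at hgrow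
  have hC : (0 : ℝ) < 2 ^ ν / ((ν - 1).factorial : ℝ) *
      ∏ j : Fin (m + 1), if ν ≤ (j : ℕ) then MixedSobolev.constB (q j) (s j / s₁) else 1 := by
    refine mul_pos (by positivity) (Finset.prod_pos fun j _ => ?_)
    split_ifs
    exacts [MixedSobolev.constB_pos _ _, one_pos]
  have := hgrow.tendsto_rpow_mul hC (σ := s₁)
    (a := fun n => approxNumber (MixedSobolev.embedding hs q) n) ?_ ?_
  · rwa [Nat.cast_sub hν, Nat.cast_one] at this
  · intro n T hn hT hle
    rw [hcard, Nat.cast_le] at hle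
    refine MixedSobolev.le_approxNumber_embedding hs hn hle (Real.rpow_pos_of_pos hT _)
      fun k hk => ?_
    rw [hsq hT, MixedSobolev.mixWeightSq_eq_rpow s q hs₁.ne']
    exact Real.rpow_le_rpow (hfin.pos k).le (by simpa using hk) (by positivity)
  · intro n T hT hlt
    rw [hcard, Nat.cast_lt] at hlt
    refine MixedSobolev.approxNumber_embedding_le hs hlt (Real.rpow_pos_of_pos hT _)
      fun k hk => ?_
    rw [hsq hT, MixedSobolev.mixWeightSq_eq_rpow s q hs₁.ne']
    have hk' : T < P k := by simpa using hk
    exact Real.rpow_le_rpow hT.le hk'.le (by positivity)
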